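/- Let $0<H<1/2$ and let $a,b$ be real numbers with $b\neq 0$. On a probability space, let $(B_t)_{t\in\mathbb R}$ be a two-sided Brownian motion and let $(B^H_t)_{t\in\mathbb R}$ be a fractional Brownian motion with Hurst index $H$, independent of $B$; that is, $B^H$ is a centered Gaussian process with stationary increments such that $B^H_0=0$ almost surely and $\mathbb E\big[(B^H_t)^2\big]=|t|^{2H}$ for all $t\in\mathbb R$. The sub-mixed fractional Brownian motion (smfBm) with parameters $a,b,H$ is the process $$S^H_t(a,b)=\frac{a\,(B_t+B_{-t})+b\,(B^H_t+B^H_{-t})}{\sqrt2},\qquad t\ge 0.$$ A process $X=(X_t)_{0\le t\le T}$ is called a weak semi-martingale if, with respect to its own filtration $\mathcal F^X_t=\sigma(X_s,\ 0\le s\le t)$, the set of random variables $$\sum_{j=0}^{n-1} f_j\,\big(X_{t_{j+1}}-X_{t_j}\big),\qquad n\in\mathbb N,\quad 0\le t_0\le\dots\le t_n\le T,\quad f_j\ \ \mathcal F^X_{t_j}\text{-measurable},\quad |f_j|\le 1\ \text{a.s.},$$ is bounded in $L^0$ (i.e. bounded in probability: for every $\varepsilon>0$ there is a constant $C$ such that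 every $Y$ in the set satisfies $\mathbb P(|Y|>C)\le\varepsilon$). Then, for every $T>0$, the process $(S^H_t(a,b))_{0\le t\le T}$ is not a weak semi-martingale. -/

import Mathlib

open MeasureTheory ProbabilityTheory
open scoped NNReal ENNReal

/-- A (real) process indexed by `ℝ` has stationary increments: for every `h`, the processes
`(X (t + h) - X h)` and `(X t - X 0)` have the same finite-dimensional laws. -/
def HasStationaryIncrements {Ω : Type*} [MeasurableSpace Ω] (X : ℝ → Ω → ℝ) (P : Measure Ω) :
    Prop :=
  ∀ (h : ℝ) (I : Finset ℝ),
    IdentDistrib (fun ω (t : I) => X ((t : ℝ) + h) ω - X h ω)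
      (fun ω (t : I) => X (t : ℝ) ω - X 0 ω) P P

/-- Fractional Brownian motion on `ℝ` with Hurst index `H`: a centered Gaussian process with
stationary increments, `X 0 = 0` almost surely and `E (X t)² = |t|^(2H)`. -/
structure IsFractionalBM {Ω : Type*} [MeasurableSpace Ω] (H : ℝ) (X : ℝ → Ω → ℝ)
    (P : Measure Ω) : Prop where
  measurable : ∀ t, Measurable (X t)
  gaussian : IsGaussianProcess X P
  centered : ∀ t, ∫ ω, X t ω ∂P = 0
  stationary : HasStationaryIncrements X P
  zero : ∀ᵐ ω ∂P, X 0 ω = 0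
  second_moment : ∀ t, ∫ ω, (X t ω) ^ 2 ∂P = |t| ^ (2 * H)

/-- Brownian motion indexed by `ℝ`: the two halves `(X t)` and `(X (-t))`, `t ≥ 0`, are
independent and each has the law of Brownian motion. Continuity of paths is not required. -/
structure IsTwoSidedBM {Ω : Type*} [MeasurableSpace Ω] (X : ℝ → Ω → ℝ) (P : Measure Ω) :
    Prop where
  measurable : ∀ t, Measurable (X t)
  right : IsPreBrownianReal (fun t : ℝ≥0 => X (t : ℝ)) P
  left : IsPreBrownianReal (fun t : ℝ≥0 => X (-(t : ℝ))) P
  indep : IndepFun (fun ω (t : ℝ≥0) => X (t : ℝ) ω) (fun ω (t : ℝ≥0) => X (-(t : ℝ)) ω) P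

/-- The sub-mixed process `(a (B t + B (-t)) + b (BH t + BH (-t))) / √2`, `t ≥ 0`. -/
noncomputable def smfBm {Ω : Type*} (a b : ℝ) (B BH : ℝ → Ω → ℝ) (t : ℝ≥0) (ω : Ω) : ℝ :=
  (a * (B (t : ℝ) ω + B (-(t : ℝ)) ω) + b * (BH (t : ℝ) ω + BH (-(t : ℝ)) ω)) / Real.sqrt 2

theorem stronglyMeasurable_smfBm {Ω : Type*} [MeasurableSpace Ω] {B BH : ℝ → Ω → ℝ}
    (hB : ∀ t, Measurable (B t)) (hBH : ∀ t, Measurable (BH t)) (a b : ℝ) (t : ℝ≥0) :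
    StronglyMeasurable (smfBm a b B BH t) := by
  have h1 := hB (t : ℝ)
  have h2 := hB (-(t : ℝ))
  have h3 := hBH (t : ℝ)
  have h4 := hBH (-(t : ℝ))
  apply Measurable.stronglyMeasurable
  unfold smfBm
  fun_prop

/-- The set `I_X(β(F))` of elementary integrals `∑_{j<n} f_j (X_{t_{j+1}} - X_{t_j})`, where
`t_0 ≤ ... ≤ t_n` lie in the index set of the process, each `f_j` is `F_{t_j}`-measurable and
`|f_j| ≤ 1` with probability one. -/
def elementaryIntegrals {Ω ι : Type*} [m : MeasurableSpace Ω] [Preorder ι]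
    (F : Filtration ι m) (X : ι → Ω → ℝ) (P : Measure Ω) : Set (Ω → ℝ) :=
  {Y | ∃ (n : ℕ) (t : Fin (n + 1) → ι) (f : Fin n → Ω → ℝ),
    Monotone t ∧
    (∀ j, Measurable[F (t j.castSucc)] (f j)) ∧
    (∀ j, ∀ᵐ ω ∂P, |f j ω| ≤ 1) ∧
    Y = fun ω => ∑ j : Fin n, f j ω * (X (t j.succ) ω - X (t j.castSucc) ω)}

/-- A set of random variables is bounded in `L⁰` (bounded in probability). -/
def BoundedInLZero {Ω : Type*} [MeasurableSpace Ω] (S : Set (Ω → ℝ)) (P : Measure Ω) : Prop :=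
  ∀ ε : ℝ≥0∞, 0 < ε → ∃ C : ℝ, ∀ Y ∈ S, P {ω | C < |Y ω|} ≤ ε

/-- `X` is a weak semi-martingale with respect to the filtration `F`. -/
def IsWeakSemimartingaleWrt {Ω ι : Type*} [m : MeasurableSpace Ω] [Preorder ι]
    (F : Filtration ι m) (X : ι → Ω → ℝ) (P : Measure Ω) : Prop :=
  Adapted F X ∧ BoundedInLZero (elementaryIntegrals F X P) P

/-- `X` is a weak semi-martingale: it is one with respect to its own filtration
`F_t = σ(X_s, s ≤ t)`. -/
def IsWeakSemimartingale {Ω ι : Type*} [m : MeasurableSpace Ω] [Preorder ι]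
    (X : ι → Ω → ℝ) (hX : ∀ t, StronglyMeasurable (X t)) (P : Measure Ω) : Prop :=
  IsWeakSemimartingaleWrt (Filtration.natural X hX) X P

/-!
The quadratic sums of a weak semi-martingale are bounded in probability, whereas those of the
sub-mixed process with `H < 1 / 2` along uniform partitions are not.

For the first assertion, integrating the indicator of "no exit from `[-C, C]` so far" gives a
maximal inequality (`exists_measure_exit_le`), so up to an event of small probability the path
`X - X_0` stays in some `[-K, K]` along any partition. There this path divided by `K` is an
admissible integrand, and the identity `∑ (Δ X) ^ 2 = (X_n - X_0) ^ 2 - 2 ∑ (X - X_0) Δ X` expresses the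
quadratic sum through a bounded quantity and `2 K` times an elementary integral
(`exists_measure_sum_sq_le`). No path regularity is involved.

For the second assertion, the increments are centered Gaussian variables, so their fourth moments
are a fixed multiple of the squares of their second moments. By the Paley-Zygmund inequality the
sum of their squares exceeds half of its mean with a probability bounded below by a universal
constant (`le_measureReal_sum_sq`), whatever the dependence between them. It remains to see that
the mean tends to infinity. By independence only the fractional part matters, and concavity of
`x ↦ x ^ (2 * H)` shows that the increment between `s ≤ t` has second moment at least
`b ^ 2 * (t - s) ^ (2 * H)` (`le_integral_smfBm_sub_sq`). Over `n` steps of length `T / n` these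
bounds add up to a multiple of `n ^ (1 - 2 * H)`.
-/

/-! ### Quadratic sums of weak semi-martingales -/

/-- Elementary integrals along the first `n` steps of a monotone sequence of times. -/
lemma sum_mem_elementaryIntegrals {Ω ι : Type*} [m : MeasurableSpace Ω] [Preorder ι]
    {F : Filtration ι m} {X : ι → Ω → ℝ} {P : Measure Ω} {u : ℕ → ι} (hu : Monotone u)
    {f : ℕ → Ω → ℝ} (hf : ∀ j, Measurable[F (u j)] (f j)) (hf1 : ∀ j ω, |f j ω| ≤ 1) (n : ℕ) :
    (fun ω => ∑ j ∈ Finset.range n, f j ω * (X (u (j + 1)) ω - X (u j) ω)) ∈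
      elementaryIntegrals F X P := by
  refine ⟨n, fun j => u j, fun j => f j, fun i j hij => hu hij, fun j => hf j,
    fun j => Filter.Eventually.of_forall (hf1 j), ?_⟩
  funext ω
  rw [Finset.sum_range]
  rfl

open Classical in
/-- The sum of the increments of `z` up to the first exit from `[z 0 - C, z 0 + C]` detects
whether an exit occurs before time `n`. -/
lemma stopped_sum_dichotomy (z : ℕ → ℝ) {C : ℝ} (hC : 0 ≤ C) (n : ℕ) :
    ((∀ i ≤ n, |z i - z 0| ≤ C) ∧
      ∑ j ∈ Finset.range n, (if ∀ i ≤ j, |z i - z 0| ≤ C then (1 : ℝ) else 0) * (z (j + 1) - z j)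
        = z n - z 0) ∨
    ((∃ i ≤ n, C < |z i - z 0|) ∧
      C < |∑ j ∈ Finset.range n,
        (if ∀ i ≤ j, |z i - z 0| ≤ C then (1 : ℝ) else 0) * (z (j + 1) - z j)|) := by
  induction n with
  | zero => left; simpa using hC
  | succ n ih =>
    rw [Finset.sum_range_succ]
    rcases ih with ⟨h1, h2⟩ | ⟨⟨i, hi, h1⟩, h2⟩
    · rw [h2, if_pos h1]
      have e : z n - z 0 + 1 * (z (n + 1) - z n) = z (n + 1) - z 0 := by ring
      rw [e]
      rcases le_or_gt |z (n + 1) - z 0| C with h | h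
      · left
        refine ⟨fun i hi => ?_, rfl⟩
        rcases Nat.le_succ_iff.1 hi with hi | rfl
        · exact h1 i hi
        · exact h
      · exact Or.inr ⟨⟨n + 1, le_rfl, h⟩, h⟩
    · right
      refine ⟨⟨i, hi.trans n.le_succ, h1⟩, ?_⟩
      rw [if_neg (fun h => absurd (h i hi) (not_le.2 h1))]
      simpa using h2

open Classical in
/-- A maximal inequality: the discretised paths of a weak semi-martingale are bounded in
probability, uniformly in the discretisation. The elementary integral of the indicator of
`{no exit of X - X_0 from [-C, C] so far}` exceeds `C` in absolute value once an exit occurs. -/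
lemma exists_measure_exit_le {Ω ι : Type*} [m : MeasurableSpace Ω] [Preorder ι]
    {F : Filtration ι m} {X : ι → Ω → ℝ} {P : Measure Ω} (h : IsWeakSemimartingaleWrt F X P)
    {ε : ℝ≥0∞} (hε : 0 < ε) :
    ∃ C : ℝ, 0 < C ∧ ∀ (u : ℕ → ι), Monotone u → ∀ n,
      P {ω | ∃ i ≤ n, C < |X (u i) ω - X (u 0) ω|} ≤ ε := by
  obtain ⟨had, hbd⟩ := h
  obtain ⟨C, hC⟩ := hbd ε hε
  refine ⟨max C 1, by positivity, fun u hu n => ?_⟩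
  have hmem := sum_mem_elementaryIntegrals (F := F) (X := X) (P := P) hu
    (f := fun j ω => if ∀ i ≤ j, |X (u i) ω - X (u 0) ω| ≤ max C 1 then (1 : ℝ) else 0)
    (fun j => by
      refine Measurable.ite ?_ measurable_const measurable_const
      have e : {ω | ∀ i ≤ j, |X (u i) ω - X (u 0) ω| ≤ max C 1}
          = ⋂ i, ⋂ (_ : i ≤ j), {ω | |X (u i) ω - X (u 0) ω| ≤ max C 1} := by
        ext ω; simp
      rw [e]
      refine MeasurableSet.iInter fun i => MeasurableSet.iInter fun hi => ?_
      have h1 : Measurable[F (u j)] (X (u i)) := (had (u i)).mono (F.mono (hu hi)) le_rfl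
      have h0 : Measurable[F (u j)] (X (u 0)) :=
        (had (u 0)).mono (F.mono (hu (Nat.zero_le j))) le_rfl
      exact measurableSet_le (measurable_abs.comp (h1.sub h0)) measurable_const)
    (fun j ω => by split_ifs <;> simp) n
  refine (measure_mono fun ω hω => ?_).trans (hC _ hmem)
  rcases stopped_sum_dichotomy (fun i => X (u i) ω) (C := max C 1) (by positivity) n with h | h
  · obtain ⟨i, hi, hlt⟩ := hω
    exact absurd (h.1 i hi) (not_le.2 hlt)
  · exact (le_max_left C 1).trans_lt h.2

/-- A discrete Itô formula for the square function. -/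
lemma sum_sq_sub (z : ℕ → ℝ) (n : ℕ) :
    ∑ j ∈ Finset.range n, (z (j + 1) - z j) ^ 2
      = (z n - z 0) ^ 2 - 2 * ∑ j ∈ Finset.range n, (z j - z 0) * (z (j + 1) - z j) := by
  induction n with
  | zero => simp
  | succ n ih => rw [Finset.sum_range_succ, Finset.sum_range_succ, ih]; ring

/-- The sums of squared increments of a weak semi-martingale are bounded in probability. By the
discrete Itô formula such a sum is the squared total increment minus twice the elementary integral
of the path `X - X_0`, and on the event where this path stays in `[-K, K]` its integral is `K` times
an elementary integral with an integrand bounded by `1`. -/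
lemma exists_measure_sum_sq_le {Ω ι : Type*} [m : MeasurableSpace Ω] [Preorder ι]
    {F : Filtration ι m} {X : ι → Ω → ℝ} {P : Measure Ω} (h : IsWeakSemimartingaleWrt F X P)
    {ε : ℝ≥0∞} (hε : 0 < ε) :
    ∃ C : ℝ, ∀ (u : ℕ → ι), Monotone u → ∀ n,
      P {ω | C < ∑ j ∈ Finset.range n, (X (u (j + 1)) ω - X (u j) ω) ^ 2} ≤ ε := by
  obtain ⟨K, hK, hexit⟩ := exists_measure_exit_le h (ENNReal.half_pos hε.ne')
  obtain ⟨had, hbd⟩ := h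
  obtain ⟨C, hC⟩ := hbd (ε / 2) (ENNReal.half_pos hε.ne')
  refine ⟨K ^ 2 + 2 * K * C, fun u hu n => ?_⟩
  -- The integrand is the path divided by `K`, truncated so that it is bounded by `1` everywhere.
  set f : ℕ → Ω → ℝ := fun j ω => max (-1) (min 1 ((X (u j) ω - X (u 0) ω) / K)) with hf
  have hmem := sum_mem_elementaryIntegrals (F := F) (X := X) (P := P) hu (f := f)
    (fun j => by
      have h1 : Measurable[F (u j)] (X (u j)) := had (u j)
      have h0 : Measurable[F (u j)] (X (u 0)) :=
        (had (u 0)).mono (F.mono (hu (Nat.zero_le j))) le_rfl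
      exact measurable_const.max (measurable_const.min ((h1.sub h0).div_const K)))
    (fun j ω => abs_le.2 ⟨le_max_left _ _, max_le (by norm_num) (min_le_left _ _)⟩) n
  rw [← ENNReal.add_halves ε]
  refine (measure_mono fun ω hω => ?_).trans
    ((measure_union_le _ _).trans (add_le_add (hexit u hu n) (hC _ hmem)))
  by_contra hcon
  simp only [Set.mem_union, Set.mem_ofPred_eq, not_or, not_exists, not_and, not_lt] at hcon hω
  obtain ⟨h1, h2⟩ := hcon
  refine absurd hω (not_lt.2 ?_)
  rw [sum_sq_sub (fun j => X (u j) ω)]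
  have e : ∑ j ∈ Finset.range n, (X (u j) ω - X (u 0) ω) * (X (u (j + 1)) ω - X (u j) ω)
      = K * ∑ j ∈ Finset.range n, f j ω * (X (u (j + 1)) ω - X (u j) ω) := by
    rw [Finset.mul_sum]
    refine Finset.sum_congr rfl fun j hj => ?_
    have hj := abs_le.1 (h1 j (Finset.mem_range.1 hj).le)
    have : f j ω = (X (u j) ω - X (u 0) ω) / K := by
      rw [hf]
      dsimp only
      rw [min_eq_right ((div_le_one hK).2 hj.2), max_eq_right]
      rw [le_div_iff₀ hK]
      linarith [hj.1]
    rw [this]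
    field_simp
  rw [e]
  have h3 := sq_le_sq.2 ((h1 n le_rfl).trans (le_abs_self K))
  have h4 := mul_le_mul_of_nonneg_left (abs_le.1 h2).1 hK.le
  linarith

/-! ### Sums of squares of Gaussian variables -/

/-- A form of the Paley-Zygmund inequality, for a variable that may take negative values. -/
lemma paley_zygmund_half {Ω : Type*} [MeasurableSpace Ω] {P : Measure Ω} [IsProbabilityMeasure P]
    {Q : Ω → ℝ} (hQm : Measurable Q) (hQ : Integrable Q P) (hQ2 : Integrable (fun ω => Q ω ^ 2) P)
    (hpos : 0 < ∫ ω, Q ω ∂P) {c : ℝ} (hc : 0 < c)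
    (h : ∫ ω, Q ω ^ 2 ∂P ≤ c * (∫ ω, Q ω ∂P) ^ 2) :
    1 / (4 * c) ≤ P.real {ω | (∫ ω, Q ω ∂P) / 2 < Q ω} := by
  set m := ∫ ω, Q ω ∂P with hm
  set A : Set Ω := {ω | m / 2 < Q ω} with hA
  have hAm : MeasurableSet A := measurableSet_lt measurable_const hQm
  have hind : Integrable (A.indicator fun _ => c * m) P := (integrable_const _).indicator hAm
  -- On `A` this is the inequality `2 x y ≤ x ^ 2 + y ^ 2`; off `A` the first term suffices.
  have hpt : ∀ ω, Q ω ≤ m / 2 + (1 / (4 * c * m)) * Q ω ^ 2 + A.indicator (fun _ => c * m) ω := by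
    intro ω
    by_cases hω : ω ∈ A
    · rw [Set.indicator_of_mem hω]
      have : 1 / (4 * c * m) * Q ω ^ 2 + c * m - Q ω
          = 1 / (4 * c * m) * (Q ω - 2 * c * m) ^ 2 := by
        field_simp
        ring
      have h0 : 0 ≤ 1 / (4 * c * m) * (Q ω - 2 * c * m) ^ 2 := by positivity
      linarith
    · rw [Set.indicator_of_notMem hω]
      have h0 : 0 ≤ 1 / (4 * c * m) * Q ω ^ 2 := by positivity
      have : Q ω ≤ m / 2 := not_lt.1 hω
      linarith
  have hint := integral_mono hQ
    (((integrable_const (m / 2)).add (hQ2.const_mul (1 / (4 * c * m)))).add hind) hpt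
  have e : ∫ ω, ((fun _ : Ω => m / 2) + (fun ω => 1 / (4 * c * m) * Q ω ^ 2)
      + A.indicator (fun _ : Ω => c * m) : Ω → ℝ) ω ∂P
      = m / 2 + 1 / (4 * c * m) * ∫ ω, Q ω ^ 2 ∂P + P.real A * (c * m) := by
    rw [integral_add' ((integrable_const (m / 2)).add (hQ2.const_mul (1 / (4 * c * m)))) hind,
      integral_add' (integrable_const (m / 2)) (hQ2.const_mul (1 / (4 * c * m))),
      integral_const_mul, integral_indicator_const _ hAm]
    simp
  rw [e, ← hm] at hint
  have h1 : 1 / (4 * c * m) * ∫ ω, Q ω ^ 2 ∂P ≤ m / 4 := by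
    calc 1 / (4 * c * m) * ∫ ω, Q ω ^ 2 ∂P ≤ 1 / (4 * c * m) * (c * m ^ 2) := by gcongr
      _ = m / 4 := by field_simp
  have h2 : m * (1 / 4) ≤ m * (P.real A * c) := by linarith
  have h3 := le_of_mul_le_mul_left h2 hpos
  rw [div_le_iff₀ (by positivity)]
  linarith

/-- If the fourth moments of the `Y i` are bounded by `c` times the squares of the second moments,
then the sum of the squares exceeds half of its mean with probability at least `1 / (4 c)`. No
assumption is made on the joint law. -/
lemma le_measureReal_sum_sq {Ω ι : Type*} [MeasurableSpace Ω] {P : Measure Ω}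
    [IsProbabilityMeasure P] {Y : ι → Ω → ℝ} {s : Finset ι} (hs : s.Nonempty)
    (hm : ∀ i, Measurable (Y i)) (h4 : ∀ i, MemLp (Y i) 4 P) {c : ℝ} (hc : 0 < c)
    (hpos : ∀ i ∈ s, 0 < ∫ ω, Y i ω ^ 2 ∂P)
    (h : ∀ i ∈ s, ∫ ω, Y i ω ^ 4 ∂P ≤ c * (∫ ω, Y i ω ^ 2 ∂P) ^ 2) :
    1 / (4 * c) ≤ P.real {ω | (∑ i ∈ s, ∫ ω, Y i ω ^ 2 ∂P) / 2 < ∑ i ∈ s, Y i ω ^ 2} := by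
  have i4 : ∀ i, Integrable (fun ω => Y i ω ^ 4) P := fun i => by
    simpa [Even.pow_abs (show Even 4 by decide)] using
      (h4 i).integrable_norm_pow (p := 4) (by norm_num)
  have i2 : ∀ i, Integrable (fun ω => Y i ω ^ 2) P := fun i =>
    ((h4 i).mono_exponent (p := 2) (by norm_num)).integrable_sq
  have hmeas : Measurable fun ω => ∑ i ∈ s, Y i ω ^ 2 :=
    Finset.measurable_fun_sum s fun i _ => (hm i).pow_const 2
  have hmean : ∫ ω, ∑ i ∈ s, Y i ω ^ 2 ∂P = ∑ i ∈ s, ∫ ω, Y i ω ^ 2 ∂P :=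
    integral_finsetSum s fun i _ => i2 i
  set v : ι → ℝ := fun i => ∫ ω, Y i ω ^ 2 ∂P with hv
  have hvpos : 0 < ∑ i ∈ s, v i := Finset.sum_pos hpos hs
  -- Cauchy-Schwarz with weights `v i`.
  have hcs : ∀ ω, (∑ i ∈ s, Y i ω ^ 2) ^ 2 ≤ (∑ i ∈ s, v i) * ∑ i ∈ s, Y i ω ^ 4 / v i := by
    intro ω
    refine Finset.sum_sq_le_sum_mul_sum_of_sq_le_mul s (fun i hi => (hpos i hi).le)
      (fun i hi => div_nonneg (by positivity) (hpos i hi).le) fun i hi => ?_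
    have : v i ≠ 0 := (hpos i hi).ne'
    refine le_of_eq ?_
    field_simp
  have iR : Integrable (fun ω => (∑ i ∈ s, v i) * ∑ i ∈ s, Y i ω ^ 4 / v i) P :=
    (integrable_finsetSum s fun i _ => (i4 i).div_const (v i)).const_mul _
  have iQ2 : Integrable (fun ω => (∑ i ∈ s, Y i ω ^ 2) ^ 2) P :=
    iR.mono' (hmeas.pow_const 2).aestronglyMeasurable
      (Filter.Eventually.of_forall fun ω => by
        rw [Real.norm_of_nonneg (sq_nonneg _)]; exact hcs ω)
  have key := paley_zygmund_half (P := P) (Q := fun ω => ∑ i ∈ s, Y i ω ^ 2) hmeas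
    (integrable_finsetSum s fun i _ => i2 i) iQ2 (by rw [hmean]; exact hvpos) hc ?_
  · rwa [hmean] at key
  · rw [hmean]
    calc ∫ ω, (∑ i ∈ s, Y i ω ^ 2) ^ 2 ∂P
        ≤ ∫ ω, (∑ i ∈ s, v i) * ∑ i ∈ s, Y i ω ^ 4 / v i ∂P := integral_mono iQ2 iR hcs
      _ = (∑ i ∈ s, v i) * ∑ i ∈ s, (∫ ω, Y i ω ^ 4 ∂P) / v i := by
        rw [integral_const_mul, integral_finsetSum s fun i _ => (i4 i).div_const (v i)]
        simp_rw [integral_div]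
      _ ≤ (∑ i ∈ s, v i) * ∑ i ∈ s, c * v i := by
        gcongr with i hi
        rw [div_le_iff₀ (hpos i hi)]
        calc _ ≤ _ := h i hi
          _ = _ := by ring
      _ = c * (∑ i ∈ s, v i) ^ 2 := by rw [← Finset.mul_sum]; ring

/-- By scaling, the fourth moment of a centered Gaussian variable is a fixed multiple of the square
of its second moment. -/
lemma integral_pow_four_of_hasGaussianLaw {Ω : Type*} [MeasurableSpace Ω] {P : Measure Ω}
    [IsProbabilityMeasure P] {Y : Ω → ℝ} (hY : HasGaussianLaw Y P) (h0 : ∫ ω, Y ω ∂P = 0) :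
    ∫ ω, Y ω ^ 4 ∂P = (∫ x, x ^ 4 ∂gaussianReal 0 1) * (∫ ω, Y ω ^ 2 ∂P) ^ 2 := by
  have hvar : Var[Y; P] = ∫ ω, Y ω ^ 2 ∂P := variance_of_integral_eq_zero hY.aemeasurable h0
  have hv0 : 0 ≤ ∫ ω, Y ω ^ 2 ∂P := integral_nonneg fun _ => sq_nonneg _
  set v := ∫ ω, Y ω ^ 2 ∂P with hv
  have hmap : P.map Y = (gaussianReal 0 1).map (√v * ·) := by
    rw [hY.map_eq_gaussianReal, gaussianReal_map_const_mul, h0, hvar]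
    congr 1
    · simp
    · ext; simp [Real.sq_sqrt hv0, hv0]
  calc ∫ ω, Y ω ^ 4 ∂P = ∫ x, x ^ 4 ∂(P.map Y) :=
        (integral_map hY.aemeasurable (continuous_pow 4).aestronglyMeasurable).symm
    _ = ∫ x, (√v * x) ^ 4 ∂gaussianReal 0 1 := by
        rw [hmap, integral_map (by fun_prop) (by fun_prop)]
    _ = _ := by
        simp_rw [mul_pow]
        rw [integral_const_mul, show √v ^ 4 = (√v ^ 2) ^ 2 by ring, Real.sq_sqrt hv0, mul_comm]

/-! ### Increments of the sub-mixed process -/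

/-- The increments of a fractional Brownian motion have second moment `|t - s| ^ (2 * H)`. -/
lemma IsFractionalBM.integral_sub_sq {Ω : Type*} [MeasurableSpace Ω] {P : Measure Ω} {H : ℝ}
    {X : ℝ → Ω → ℝ} (hX : IsFractionalBM H X P) (s t : ℝ) :
    ∫ ω, (X t ω - X s ω) ^ 2 ∂P = |t - s| ^ (2 * H) := by
  have hid := ((hX.stationary s {t - s}).comp (u := fun x => (x ⟨t - s, by simp⟩) ^ 2)
    ((measurable_pi_apply _).pow_const 2)).integral_eq
  simp only [Function.comp_def, sub_add_cancel] at hid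
  rw [hid, ← hX.second_moment (t - s)]
  refine integral_congr_ae ?_
  filter_upwards [hX.zero] with ω hω
  rw [hω, sub_zero]

lemma IsFractionalBM.integrable_sub_sq {Ω : Type*} [MeasurableSpace Ω] {P : Measure Ω} {H : ℝ}
    {X : ℝ → Ω → ℝ} (hX : IsFractionalBM H X P) (s t : ℝ) :
    Integrable (fun ω => (X t ω - X s ω) ^ 2) P :=
  ((hX.gaussian.hasGaussianLaw_eval t).memLp_two.sub
    (hX.gaussian.hasGaussianLaw_eval s).memLp_two).integrable_sq

/-- The symmetrised increment of a fractional Brownian motion is a linear combination of four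
values whose coefficients add up to `0`, so its square is a combination of squares of differences.
Concavity of `x ↦ x ^ (2 * H)` then bounds its second moment from below. -/
lemma IsFractionalBM.le_integral_symm_increment_sq {Ω : Type*} [MeasurableSpace Ω]
    {P : Measure Ω} {H : ℝ} {X : ℝ → Ω → ℝ} (hX : IsFractionalBM H X P) (hH0 : 0 < H)
    (hH : H < 1 / 2) {s t : ℝ} (hs : 0 ≤ s) (hst : s ≤ t) :
    2 * (t - s) ^ (2 * H) ≤ ∫ ω, (X t ω + X (-t) ω - (X s ω + X (-s) ω)) ^ 2 ∂P := by
  have ht : 0 ≤ t := hs.trans hst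
  have e : ∀ ω, (X t ω + X (-t) ω - (X s ω + X (-s) ω)) ^ 2
      = (X t ω - X s ω) ^ 2 + (X t ω - X (-s) ω) ^ 2 + (X (-t) ω - X s ω) ^ 2
        + (X (-t) ω - X (-s) ω) ^ 2 - (X t ω - X (-t) ω) ^ 2 - (X s ω - X (-s) ω) ^ 2 := by
    intro ω; ring
  have i := hX.integrable_sub_sq
  simp_rw [e]
  rw [integral_sub (by fun_prop) (i _ _), integral_sub (by fun_prop) (i _ _),
    integral_add (by fun_prop) (i _ _), integral_add (by fun_prop) (i _ _),
    integral_add (i _ _) (i _ _)]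
  simp_rw [hX.integral_sub_sq]
  have h1 : |t - s| = t - s := abs_of_nonneg (by linarith)
  have h2 : |t - -s| = t + s := by rw [abs_of_nonneg (by linarith)]; ring
  have h3 : |-t - s| = t + s := by rw [abs_of_nonpos (by linarith)]; ring
  have h4 : |-t - -s| = t - s := by rw [abs_of_nonpos (by linarith)]; ring
  have h5 : |t - -t| = 2 * t := by rw [abs_of_nonneg (by linarith)]; ring
  have h6 : |s - -s| = 2 * s := by rw [abs_of_nonneg (by linarith)]; ring
  rw [h1, h2, h3, h4, h5, h6]
  have hconc := (Real.concaveOn_rpow (p := 2 * H) (by linarith) (by linarith)).2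
    (show (2 * t) ∈ Set.Ici (0 : ℝ) from Set.mem_Ici.2 (by linarith))
    (show (2 * s) ∈ Set.Ici (0 : ℝ) from Set.mem_Ici.2 (by linarith))
    (show (0 : ℝ) ≤ 1 / 2 by norm_num) (show (0 : ℝ) ≤ 1 / 2 by norm_num) (by norm_num)
  simp only [smul_eq_mul] at hconc
  rw [show 1 / 2 * (2 * t) + 1 / 2 * (2 * s) = t + s by ring] at hconc
  linarith

lemma IsFractionalBM.hasGaussianLaw_symm_increment {Ω : Type*} [MeasurableSpace Ω]
    {P : Measure Ω} {H : ℝ} {X : ℝ → Ω → ℝ} (hX : IsFractionalBM H X P) (s t : ℝ) :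
    HasGaussianLaw (fun ω => X t ω + X (-t) ω - (X s ω + X (-s) ω)) P := by
  let I : Finset ℝ := {t, -t, s, -s}
  let p (r : ℝ) (hr : r ∈ I) : (I → ℝ) →L[ℝ] ℝ := ContinuousLinearMap.proj ⟨r, hr⟩
  exact (hX.gaussian.hasGaussianLaw I).map_fun
    (p t (by simp [I]) + p (-t) (by simp [I]) - (p s (by simp [I]) + p (-s) (by simp [I])))

lemma IsFractionalBM.integral_symm_increment {Ω : Type*} [MeasurableSpace Ω]
    {P : Measure Ω} {H : ℝ} {X : ℝ → Ω → ℝ} (hX : IsFractionalBM H X P) (s t : ℝ) :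
    ∫ ω, (X t ω + X (-t) ω - (X s ω + X (-s) ω)) ∂P = 0 := by
  have i : ∀ r, Integrable (X r) P := fun r => (hX.gaussian.hasGaussianLaw_eval r).integrable
  rw [integral_sub (by fun_prop) (by fun_prop), integral_add (i _) (i _),
    integral_add (i _) (i _)]
  simp [hX.centered]

lemma IsTwoSidedBM.hasGaussianLaw_symm_increment {Ω : Type*} [MeasurableSpace Ω]
    {P : Measure Ω} {X : ℝ → Ω → ℝ} (hX : IsTwoSidedBM X P) (s t : ℝ≥0) :
    HasGaussianLaw (fun ω => X t ω + X (-t) ω - (X s ω + X (-s) ω)) P := by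
  have h := iIndepFun.hasGaussianLaw_add (hX.right.hasLaw_sub t s).hasGaussianLaw
    (hX.left.hasLaw_sub t s).hasGaussianLaw
    (hX.indep.comp (φ := fun f : ℝ≥0 → ℝ => f t - f s) (ψ := fun f : ℝ≥0 → ℝ => f t - f s)
      (by fun_prop) (by fun_prop))
  refine h.congr (Filter.Eventually.of_forall fun ω => ?_)
  simp only [Pi.add_apply, Pi.sub_apply]
  ring

lemma IsTwoSidedBM.integral_symm_increment {Ω : Type*} [MeasurableSpace Ω]
    {P : Measure Ω} {X : ℝ → Ω → ℝ} (hX : IsTwoSidedBM X P) (s t : ℝ≥0) :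
    ∫ ω, (X t ω + X (-t) ω - (X s ω + X (-s) ω)) ∂P = 0 := by
  have i : ∀ r : ℝ≥0, Integrable (X r) P := hX.right.integrable_eval
  have i' : ∀ r : ℝ≥0, Integrable (X (-r)) P := hX.left.integrable_eval
  have z : ∀ r : ℝ≥0, ∫ ω, X r ω ∂P = 0 := hX.right.integral_eval
  have z' : ∀ r : ℝ≥0, ∫ ω, X (-r) ω ∂P = 0 := hX.left.integral_eval
  rw [integral_sub (by fun_prop) (by fun_prop), integral_add (i _) (i' _),
    integral_add (i _) (i' _)]
  simp [z, z']

lemma smfBm_sub {Ω : Type*} (a b : ℝ) (B BH : ℝ → Ω → ℝ) (s t : ℝ≥0) (ω : Ω) :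
    smfBm a b B BH t ω - smfBm a b B BH s ω
      = a / √2 * (B t ω + B (-t) ω - (B s ω + B (-s) ω))
        + b / √2 * (BH t ω + BH (-t) ω - (BH s ω + BH (-s) ω)) := by
  unfold smfBm
  ring

section Increment

variable {Ω : Type*} [MeasurableSpace Ω] {P : Measure Ω} {H : ℝ} {B BH : ℝ → Ω → ℝ}

/-- The two symmetrised increments that make up an increment of `smfBm` are independent. -/
lemma indepFun_symm_increment
    (hindep : IndepFun (fun ω (t : ℝ) => B t ω) (fun ω (t : ℝ) => BH t ω) P) (s t : ℝ) :
    IndepFun (fun ω => B t ω + B (-t) ω - (B s ω + B (-s) ω))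
      (fun ω => BH t ω + BH (-t) ω - (BH s ω + BH (-s) ω)) P :=
  hindep.comp (φ := fun f : ℝ → ℝ => f t + f (-t) - (f s + f (-s)))
    (ψ := fun f : ℝ → ℝ => f t + f (-t) - (f s + f (-s))) (by fun_prop) (by fun_prop)

lemma hasGaussianLaw_smfBm_sub (a b : ℝ) (hB : IsTwoSidedBM B P) (hBH : IsFractionalBM H BH P)
    (hindep : IndepFun (fun ω (t : ℝ) => B t ω) (fun ω (t : ℝ) => BH t ω) P) (s t : ℝ≥0) :
    HasGaussianLaw (fun ω => smfBm a b B BH t ω - smfBm a b B BH s ω) P := by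
  simp_rw [smfBm_sub]
  exact iIndepFun.hasGaussianLaw_fun_add
    ((hB.hasGaussianLaw_symm_increment s t).fun_smul (a / √2))
    ((hBH.hasGaussianLaw_symm_increment s t).fun_smul (b / √2))
    ((indepFun_symm_increment hindep s t).comp (φ := fun x => a / √2 * x)
      (ψ := fun x => b / √2 * x) (by fun_prop) (by fun_prop))

lemma integral_smfBm_sub (a b : ℝ) (hB : IsTwoSidedBM B P) (hBH : IsFractionalBM H BH P)
    (s t : ℝ≥0) :
    ∫ ω, (smfBm a b B BH t ω - smfBm a b B BH s ω) ∂P = 0 := by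
  simp_rw [smfBm_sub]
  rw [integral_add ((hB.hasGaussianLaw_symm_increment s t).integrable.const_mul _)
    ((hBH.hasGaussianLaw_symm_increment s t).integrable.const_mul _), integral_const_mul,
    integral_const_mul, hB.integral_symm_increment, hBH.integral_symm_increment]
  simp

/-- By independence the Brownian part can only increase the second moment of an increment. -/
lemma le_integral_smfBm_sub_sq (a b : ℝ) (hB : IsTwoSidedBM B P) (hBH : IsFractionalBM H BH P)
    (hindep : IndepFun (fun ω (t : ℝ) => B t ω) (fun ω (t : ℝ) => BH t ω) P)
    (hH0 : 0 < H) (hH : H < 1 / 2) {s t : ℝ≥0} (hst : s ≤ t) :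
    b ^ 2 * ((t : ℝ) - s) ^ (2 * H) ≤
      ∫ ω, (smfBm a b B BH t ω - smfBm a b B BH s ω) ^ 2 ∂P := by
  have hU := hB.hasGaussianLaw_symm_increment s t
  have hV := hBH.hasGaussianLaw_symm_increment s t
  have hUV := indepFun_symm_increment hindep s t
  have hV2 := hBH.le_integral_symm_increment_sq hH0 hH s.coe_nonneg (NNReal.coe_le_coe.2 hst)
  have hU0 := hB.integral_symm_increment s t
  simp_rw [smfBm_sub]
  set U : Ω → ℝ := fun ω => B t ω + B (-t) ω - (B s ω + B (-s) ω)
  set V : Ω → ℝ := fun ω => BH t ω + BH (-t) ω - (BH s ω + BH (-s) ω)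
  change _ ≤ ∫ ω, V ω ^ 2 ∂P at hV2
  have hcross : ∫ ω, U ω * V ω ∂P = 0 := by
    rw [hUV.integral_fun_mul_eq_mul_integral hU.aemeasurable.aestronglyMeasurable
      hV.aemeasurable.aestronglyMeasurable, hU0, zero_mul]
  have e : ∀ ω, (a / √2 * U ω + b / √2 * V ω) ^ 2
      = a ^ 2 / 2 * U ω ^ 2 + b ^ 2 / 2 * V ω ^ 2 + a * b * (U ω * V ω) := by
    intro ω
    have h2 : √2 ^ 2 = (2 : ℝ) := Real.sq_sqrt (by norm_num)
    field_simp
    rw [h2]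
    ring
  have iU : Integrable (fun ω => U ω ^ 2) P := hU.memLp_two.integrable_sq
  have iV : Integrable (fun ω => V ω ^ 2) P := hV.memLp_two.integrable_sq
  have iUV : Integrable (fun ω => U ω * V ω) P := hU.memLp_two.integrable_mul hV.memLp_two
  change _ ≤ ∫ ω, (a / √2 * U ω + b / √2 * V ω) ^ 2 ∂P
  simp_rw [e]
  rw [integral_add (by fun_prop) (iUV.const_mul _),
    integral_add (iU.const_mul _) (iV.const_mul _), integral_const_mul, integral_const_mul,
    integral_const_mul, hcross]
  have hU2 : 0 ≤ a ^ 2 / 2 * ∫ ω, U ω ^ 2 ∂P :=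
    mul_nonneg (by positivity) (integral_nonneg fun _ => sq_nonneg _)
  have h := mul_le_mul_of_nonneg_left hV2 (show 0 ≤ b ^ 2 / 2 by positivity)
  rw [show b ^ 2 / 2 * (2 * ((t : ℝ) - s) ^ (2 * H)) = b ^ 2 * ((t : ℝ) - s) ^ (2 * H) by ring] at h
  rw [mul_zero, add_zero]
  exact h.trans (le_add_of_nonneg_left hU2)

end Increment

/-! ### Unboundedness of the quadratic sums -/

/-- For `p < 1` the sum of the `p`-th powers of `n` steps of length `T / n` is unbounded in `n`. -/
lemma tendsto_mul_div_rpow_atTop {p T : ℝ} (hp : p < 1) (hT : 0 < T) :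
    Filter.Tendsto (fun n : ℕ => (n : ℝ) * (T / n) ^ p) Filter.atTop Filter.atTop := by
  have h := ((tendsto_rpow_atTop (sub_pos.2 hp)).comp
    (tendsto_natCast_atTop_atTop (R := ℝ))).const_mul_atTop (Real.rpow_pos_of_pos hT p)
  refine h.congr' ?_
  filter_upwards [Filter.eventually_gt_atTop 0] with n hn
  have hn : (0 : ℝ) < n := Nat.cast_pos.2 hn
  have := (Real.rpow_pos_of_pos hn p).ne'
  simp only [Function.comp_apply]
  rw [Real.div_rpow hT.le hn.le, Real.rpow_sub hn, Real.rpow_one]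
  field_simp

theorem mainTheorem4 {Ω : Type*} [MeasurableSpace Ω] (P : Measure Ω) [IsProbabilityMeasure P]
    (H a b : ℝ) (hH0 : 0 < H) (hH : H < 1 / 2) (hb : b ≠ 0)
    (B BH : ℝ → Ω → ℝ) (hB : IsTwoSidedBM B P) (hBH : IsFractionalBM H BH P)
    (hindep : IndepFun (fun ω (t : ℝ) => B t ω) (fun ω (t : ℝ) => BH t ω) P)
    (T : ℝ≥0) (hT : 0 < T) :
    ¬ IsWeakSemimartingale (fun t : Set.Icc (0 : ℝ≥0) T => smfBm a b B BH (t : ℝ≥0))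
      (fun t => stronglyMeasurable_smfBm hB.measurable hBH.measurable a b (t : ℝ≥0)) P := by
  intro hweak
  set c : ℝ := max (∫ x, x ^ 4 ∂gaussianReal 0 1) 1
  have hcpos : 0 < c := by positivity
  -- Any level below the Paley-Zygmund bound `1 / (4 c)` leads to a contradiction.
  obtain ⟨C, hC⟩ := exists_measure_sum_sq_le hweak (ε := ENNReal.ofReal (1 / (8 * c)))
    (ENNReal.ofReal_pos.2 (by positivity))
  have hT' : (0 : ℝ) < T := hT
  have hlim := (tendsto_mul_div_rpow_atTop (p := 2 * H) (by linarith) hT').const_mul_atTop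
    (show 0 < b ^ 2 / 2 by positivity)
  obtain ⟨n, hnC, hn⟩ := ((hlim.eventually_ge_atTop C).and (Filter.eventually_gt_atTop 0)).exists
  have hn' : (0 : ℝ) < n := Nat.cast_pos.2 hn
  -- The uniform partition of `[0, T]` into `n` steps, constant from the `n`-th point on.
  let u : ℕ → Set.Icc (0 : ℝ≥0) T := fun j => ⟨min (j * (T / n)) T, zero_le, min_le_right _ _⟩
  have hu : Monotone u := fun i j hij =>
    Subtype.mk_le_mk.2 (min_le_min_right _ (by gcongr))
  have hval : ∀ j ≤ n, ((u j : ℝ≥0) : ℝ) = j * (T / n) := by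
    intro j hj
    have hj' : (j : ℝ≥0) * (T / n) ≤ T := by
      rw [mul_div_left_comm]
      exact mul_le_of_le_one_right zero_le (div_le_one_of_le₀ (by exact_mod_cast hj) zero_le)
    simp only [u, min_eq_left hj']
    push_cast
    rfl
  set Y : ℕ → Ω → ℝ := fun j ω => smfBm a b B BH (u (j + 1)) ω - smfBm a b B BH (u j) ω
  have hgauss : ∀ j, HasGaussianLaw (Y j) P :=
    fun j => hasGaussianLaw_smfBm_sub a b hB hBH hindep _ _
  have hlow : ∀ j ∈ Finset.range n, b ^ 2 * ((T : ℝ) / n) ^ (2 * H) ≤ ∫ ω, Y j ω ^ 2 ∂P := by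
    intro j hj
    have hj := Finset.mem_range.1 hj
    have h := le_integral_smfBm_sub_sq a b hB hBH hindep hH0 hH (hu j.le_succ)
    rw [hval j hj.le, hval (j + 1) hj] at h
    convert h using 3
    push_cast
    ring
  have hstep : 0 < b ^ 2 * ((T : ℝ) / n) ^ (2 * H) := by positivity
  have key := le_measureReal_sum_sq (P := P) (Y := Y) (s := Finset.range n)
    (Finset.nonempty_range_iff.2 hn.ne')
    (fun j => (stronglyMeasurable_smfBm hB.measurable hBH.measurable a b _).measurable.sub
      (stronglyMeasurable_smfBm hB.measurable hBH.measurable a b _).measurable)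
    (fun j => (hgauss j).memLp (by norm_num)) hcpos (fun j hj => hstep.trans_le (hlow j hj))
    (fun j _ => by
      rw [integral_pow_four_of_hasGaussianLaw (hgauss j) (integral_smfBm_sub a b hB hBH _ _)]
      gcongr
      exact le_max_left _ _)
  have hmean : C ≤ (∑ j ∈ Finset.range n, ∫ ω, Y j ω ^ 2 ∂P) / 2 := by
    have h := Finset.card_nsmul_le_sum _ _ _ hlow
    rw [Finset.card_range, nsmul_eq_mul] at h
    have e : b ^ 2 / 2 * (n * ((T : ℝ) / n) ^ (2 * H))
        = n * (b ^ 2 * ((T : ℝ) / n) ^ (2 * H)) / 2 := by ring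
    linarith
  have hle : P.real {ω | (∑ j ∈ Finset.range n, ∫ ω, Y j ω ^ 2 ∂P) / 2
      < ∑ j ∈ Finset.range n, Y j ω ^ 2} ≤ 1 / (8 * c) := by
    refine ENNReal.toReal_le_of_le_ofReal (by positivity) ?_
    exact (measure_mono fun ω hω => hmean.trans_lt hω).trans (hC u hu n)
  have hlt : 1 / (8 * c) < 1 / (4 * c) := by gcongr; norm_num
  linarith
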